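/- **Model.** A capacitated graph is a finite connected simple graph $G=(V,E)$ on $n$ anonymous nodes with a capacity function $c:V\to\{0,1,\dots,k^p\}$ such that $\sum_{v}c(v)\ge k$; at each node $v$ the incident edges carry the local port numbers $0,\dots,\deg(v)-1$. There are $k>1$ robots with pairwise distinct IDs in $[1,k^q]$; here $p,q$ are positive constants. One robot is the shepherd: it is never Byzantine, and a robot recognizes with certainty whether a co-located robot is the shepherd. At most $f$ robots are strong Byzantine. Time proceeds in synchronous rounds, and all robots start at the same time. In each round every robot shows an ID and shouts one message (of any size, or none) to all robots on its node. Each robot perceives its node's degree and capacity, the port through which it has just entered, and, for each co-located robot, the shown ID, the message, and whether that robot is the shepherd. It then performs local computation with unlimited memory, and stays, moves through a port to a neighbour, or terminates; a terminated robot stays at its node, silent, forever. Non-Byzantine robots follow the deterministic algorithm and show their true ID; Byzantine robots may show any ID, shout any message and make any move along edges, but each shows one ID and one message per round, heard alike by all robots on its node. Initially a robot knows only its own ID and whether it is the shepherd; the shepherd moreover knows $n$ and $k$. Neither the graph, nor $c$, nor $f$ is known to any robot. Byzantine dispersion is solved within $T$ rounds if, whatever the Byzantine robots do, after some number $t\le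 T$ of rounds all non-Byzantine robots have terminated and every node $u$ carries at most $c(u)$ non-Byzantine robots. **Corollary.** There exist a deterministic algorithm and an absolute constant $C$ such that for all $n$, $k$ and all $f<\lfloor (k-1)/2\rfloor$, if all $k$ robots are initially gathered at one node of a capacitated graph with $n$ nodes and at most $f$ of them are strong Byzantine, then the algorithm solves Byzantine dispersion within $C\,n^3$ rounds. -/

import Mathlib

namespace ByzantineDispersion

/-- A simple graph with a local port numbering: the edges at `v` are numbered
`0, …, deg v - 1`, independently at each node (so `deg v` is the degree of `v`). -/
structure PortGraph (V : Type) where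
  graph : SimpleGraph V
  deg : V → ℕ
  port : (v : V) → Fin (deg v) ≃ graph.neighborSet v

/-- Leaving `v` through port `p`: the node reached and the port there through which it is
entered; `none` if `v` has no port `p`. -/
def PortGraph.traverse {V : Type} (G : PortGraph V) (v : V) (p : ℕ) : Option (V × ℕ) :=
  if h : p < G.deg v then
    some ((G.port v ⟨p, h⟩).1,
      ((G.port (G.port v ⟨p, h⟩).1).symm ⟨v, (G.port v ⟨p, h⟩).2.symm⟩).1)
  else none

/-- What a robot perceives of the (anonymous) node it is on. -/
structure View where
  degree : ℕ
  capacity : ℕ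
  /-- The port through which the robot entered in the preceding round; `none` if it did not
  move in that round. -/
  entry : Option ℕ

/-- What a robot perceives of one co-located robot in one round: whether it is the shepherd,
the label (ID) it shows, and what it shouts (`none` if it is silent). -/
structure Shout (Msg : Type) where
  isShepherd : Bool
  label : ℕ
  msg : Option Msg

/-- What a robot may decide to do at the end of a round. -/
inductive Action where
  | stay
  | move (port : ℕ)
  | terminate

/-- A deterministic distributed algorithm for robots with unlimited memory. The shepherd
initially knows `n`, `k` and its ID; every other robot initially knows only its ID. In each
round a robot shouts `speak state view`, and then computes its new state and its action from its
state, its view and the multiset of what it perceives of the co-located other robots. -/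
structure Algorithm where
  State : Type
  Msg : Type
  initShepherd : (n k id : ℕ) → State
  initRobot : (id : ℕ) → State
  speak : State → View → Msg
  step : State → View → Multiset (Shout Msg) → State × Action

/-- `k` robots on a capacitated graph: their IDs, the shepherd, the Byzantine robots and the
starting nodes. -/
structure Instance (V : Type) (k : ℕ) where
  net : PortGraph V
  cap : V → ℕ
  id : Fin k → ℕ
  shepherd : Fin k
  byz : Finset (Fin k)
  start : Fin k → V

/-- The standing assumptions: connected graph, total capacity at least `k`, capacities in
`[0, k ^ p]`, unique IDs in `[1, k ^ q]`, a shepherd that is not Byzantine, and at most `f`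
Byzantine robots. -/
structure Instance.Valid {V : Type} [Fintype V] {k : ℕ} (I : Instance V k) (f p q : ℕ) :
    Prop where
  connected : I.net.graph.Connected
  total_cap : k ≤ ∑ v, I.cap v
  cap_le : ∀ v, I.cap v ≤ k ^ p
  id_injective : Function.Injective I.id
  id_mem : ∀ i, I.id i ∈ Set.Icc 1 (k ^ q)
  shepherd_honest : I.shepherd ∉ I.byz
  card_byz_le : I.byz.card ≤ f

/-- All robots start at one node. -/
def Instance.Gathered {V : Type} {k : ℕ} (I : Instance V k) : Prop :=
  ∃ r : V, ∀ i, I.start i = r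

/-- A behaviour of the strong Byzantine robots: in each round, the label each of them shows, what
it shouts, and the port through which it leaves (`none`: it stays). These are arbitrary; since
the honest robots are deterministic, quantifying over all such sequences covers every adaptive
and coordinated adversary. (The values at non-Byzantine robots are not used.) -/
structure Adversary (Msg : Type) (k : ℕ) where
  label : ℕ → Fin k → ℕ
  msg : ℕ → Fin k → Option Msg
  exit : ℕ → Fin k → Option ℕ

/-- The situation of one robot. `memory = none` means that the robot has terminated. (The memory
of a Byzantine robot plays no role.) -/
structure RobotState (State V : Type) where
  loc : V
  entry : Option ℕ
  memory : Option State

section Execution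

variable {V : Type} {k : ℕ} (A : Algorithm) (I : Instance V k)
  (adv : Adversary A.Msg k)

/-- The situation of robot `i` before the first round. -/
def initial [Fintype V] (i : Fin k) : RobotState A.State V where
  loc := I.start i
  entry := none
  memory := some (if i = I.shepherd then A.initShepherd (Fintype.card V) k (I.id i)
    else A.initRobot (I.id i))

/-- The view of a robot on its current node. -/
def viewOf {State : Type} (x : RobotState State V) : View where
  degree := I.net.deg x.loc
  capacity := I.cap x.loc
  entry := x.entry

/-- What robot `j` shows and shouts in round `t`. A terminated robot is silent. -/
def shoutOf (t : ℕ) (cfg : Fin k → RobotState A.State V) (j : Fin k) : Shout A.Msg where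
  isShepherd := decide (j = I.shepherd)
  label := if j ∈ I.byz then adv.label t j else I.id j
  msg := if j ∈ I.byz then adv.msg t j
    else (cfg j).memory.map fun s => A.speak s (viewOf I (cfg j))

open Classical in
/-- What robot `i` perceives of the other robots on its node in round `t`. -/
noncomputable def heard (t : ℕ) (cfg : Fin k → RobotState A.State V) (i : Fin k) :
    Multiset (Shout A.Msg) :=
  (Finset.univ.filter fun j => j ≠ i ∧ (cfg j).loc = (cfg i).loc).val.map
    (shoutOf A I adv t cfg)

/-- A robot at `v` leaves through port `p`, with memory `mem` afterwards; it stays if there is no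
such port. -/
def depart {State : Type} (v : V) (p : ℕ) (mem : Option State) : RobotState State V :=
  match I.net.traverse v p with
  | some (w, r) => ⟨w, some r, mem⟩
  | none => ⟨v, none, mem⟩

/-- The situation of robot `i` after round `t`, where `cfg` is the configuration before it. -/
noncomputable def next (t : ℕ) (cfg : Fin k → RobotState A.State V) (i : Fin k) :
    RobotState A.State V :=
  if i ∈ I.byz then
    match adv.exit t i with
    | some p => depart I (cfg i).loc p (cfg i).memory
    | none => ⟨(cfg i).loc, none, (cfg i).memory⟩
  else
    match (cfg i).memory with
    | none => cfg i
    | some s =>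
      match A.step s (viewOf I (cfg i)) (heard A I adv t cfg i) with
      | (s', Action.stay) => ⟨(cfg i).loc, none, some s'⟩
      | (s', Action.move p) => depart I (cfg i).loc p (some s')
      | (_, Action.terminate) => ⟨(cfg i).loc, none, none⟩

/-- The configuration after `t` rounds. -/
noncomputable def config [Fintype V] : ℕ → Fin k → RobotState A.State V
  | 0 => initial A I
  | t + 1 => next A I adv t (config t)

open Classical in
/-- After `t` rounds, all non-Byzantine robots have terminated, and every node `u` carries at most
`c(u)` of them. (Terminated robots never move again.) -/
def DispersedAt [Fintype V] (t : ℕ) : Prop :=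
  (∀ i, i ∉ I.byz → (config A I adv t i).memory = none) ∧
  ∀ u : V, (Finset.univ.filter fun i => i ∉ I.byz ∧ (config A I adv t i).loc = u).card ≤ I.cap u

/-- The algorithm solves Byzantine dispersion on the instance within `T` rounds, whatever the
Byzantine robots do. -/
def SolvesWithin [Fintype V] (T : ℕ) : Prop :=
  ∀ adv : Adversary A.Msg k, ∃ t ≤ T, DispersedAt A I adv t

end Execution

end ByzantineDispersion

/-!
The honest robots other than the shepherd stay together as a *flock* that obeys the shepherd. Fewer
than half of the robots are Byzantine, so the shepherd can tell from the mere number of robots on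
its node whether the flock is there: the flock is a pebble that Byzantine robots cannot forge. With
this pebble the shepherd draws a map. As long as some port of a recorded node is not known to lead
to a recorded node, it leads the flock through this port to a node which must be new, leaves the
flock there, and tries all ports of the recorded nodes; the ports behind which it meets the flock
are those of the edges between the new node and the recorded ones. A new node costs `O(n ^ 2)`
rounds and there are at most `n` of them. When no unknown port is left, the map is complete by
connectedness, and the shepherd assigns distinct places to all IDs it sees on its node. A Byzantine
robot may claim any label, but only one, so at most `k` places are needed.
-/

namespace ByzantineDispersion

/-! ### Port-numbered graphs -/

namespace PortGraph

variable {V : Type} (G : PortGraph V) {u v : V} {p r : ℕ}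

lemma traverse_eq_some_iff :
    G.traverse u p = some (v, r) ↔
      ∃ (hp : p < G.deg u) (hr : r < G.deg v),
        (G.port u ⟨p, hp⟩).1 = v ∧ (G.port v ⟨r, hr⟩).1 = u := by
  unfold traverse
  constructor
  · intro h
    split_ifs at h with hp
    obtain ⟨rfl, rfl⟩ := Prod.mk.inj (Option.some.inj h)
    exact ⟨hp, Fin.isLt _, rfl, by simp⟩
  · rintro ⟨hp, hr, rfl, hback⟩
    have hentry : (G.port (G.port u ⟨p, hp⟩).1).symm ⟨u, (G.port u ⟨p, hp⟩).2.symm⟩ = ⟨r, hr⟩ :=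
      (Equiv.symm_apply_eq _).2 (Subtype.ext hback.symm)
    rw [dif_pos hp, hentry]

variable {G}

lemma traverse_symm (h : G.traverse u p = some (v, r)) : G.traverse v r = some (u, p) := by
  obtain ⟨hp, hr, hto, hback⟩ := G.traverse_eq_some_iff.1 h
  exact G.traverse_eq_some_iff.2 ⟨hr, hp, hback, hto⟩

lemma lt_deg_of_traverse (h : G.traverse u p = some (v, r)) : p < G.deg u :=
  (G.traverse_eq_some_iff.1 h).1

lemma adj_of_traverse (h : G.traverse u p = some (v, r)) : G.graph.Adj u v := by
  obtain ⟨hp, _, rfl, _⟩ := G.traverse_eq_some_iff.1 h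
  exact (G.port u ⟨p, hp⟩).2

lemma exists_traverse_of_lt_deg (h : p < G.deg u) : ∃ v r, G.traverse u p = some (v, r) :=
  ⟨_, _, dif_pos h⟩

lemma exists_traverse_of_adj (h : G.graph.Adj u v) : ∃ p r, G.traverse u p = some (v, r) :=
  ⟨(G.port u).symm ⟨v, h⟩, (G.port v).symm ⟨u, h.symm⟩,
    G.traverse_eq_some_iff.2 ⟨Fin.isLt _, Fin.isLt _, by simp, by simp⟩⟩

variable (G)

lemma deg_le_card [Fintype V] (v : V) : G.deg v ≤ Fintype.card V := by
  simpa using Fintype.card_le_of_injective (fun p => (G.port v p).1)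
    (Subtype.val_injective.comp (G.port v).injective)

/-- The node reached by leaving `v` through port `p`, and the port through which it is entered. As
in `depart`, one stays if there is no such port. -/
def leave (v : V) (p : ℕ) : V × Option ℕ :=
  match G.traverse v p with
  | some (w, r) => (w, some r)
  | none => (v, none)

/-- The node reached from `v` by leaving through the listed ports in turn. -/
def follow (v : V) (ps : List ℕ) : V :=
  ps.foldl (fun v p => (G.leave v p).1) v

variable {G}

lemma leave_of_traverse (h : G.traverse u p = some (v, r)) : G.leave u p = (v, some r) := by
  simp only [leave, h]

lemma follow_singleton_of_traverse (h : G.traverse u p = some (v, r)) : G.follow u [p] = v := by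
  simp only [follow, List.foldl_cons, List.foldl_nil, leave_of_traverse h]

lemma follow_append (ps qs : List ℕ) : G.follow u (ps ++ qs) = G.follow (G.follow u ps) qs :=
  List.foldl_append

end PortGraph

/-! ### Executions of an arbitrary algorithm -/

/-- The flock: the non-Byzantine robots other than the shepherd. -/
def Instance.flock {V : Type} {k : ℕ} (I : Instance V k) : Finset (Fin k) :=
  (insert I.shepherd I.byz)ᶜ

section Execution

variable {V : Type} {k : ℕ} {I : Instance V k} {i j : Fin k}

lemma Instance.mem_flock : i ∈ I.flock ↔ i ≠ I.shepherd ∧ i ∉ I.byz := by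
  simp [flock]

lemma Instance.card_flock (hs : I.shepherd ∉ I.byz) : I.flock.card = k - (I.byz.card + 1) := by
  rw [flock, Finset.card_compl, Finset.card_insert_of_notMem hs, Fintype.card_fin]

variable (I) in
/-- The situation of a robot on `v` after it has computed the given memory and action. -/
def perform {State : Type} (v : V) : State × Action → RobotState State V
  | (s, .stay) => ⟨v, none, some s⟩
  | (s, .move p) => depart I v p (some s)
  | (_, .terminate) => ⟨v, none, none⟩

lemma depart_eq_leave {State : Type} (v : V) (p : ℕ) (m : Option State) :
    depart I v p m = ⟨(I.net.leave v p).1, (I.net.leave v p).2, m⟩ := by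
  unfold depart PortGraph.leave
  rcases I.net.traverse v p with _ | ⟨w, r⟩ <;> rfl

variable {A : Algorithm} {adv : Adversary A.Msg k} {t : ℕ} {cfg : Fin k → RobotState A.State V}

lemma shoutOf_mem_heard (hij : j ≠ i) (hloc : (cfg j).loc = (cfg i).loc) :
    shoutOf A I adv t cfg j ∈ heard A I adv t cfg i :=
  Multiset.mem_map_of_mem _ (by simpa using ⟨hij, hloc⟩)

lemma card_heard_lt (cfg : Fin k → RobotState A.State V) (i : Fin k) :
    (heard A I adv t cfg i).card < k := by
  classical
  rw [heard, Multiset.card_map, Finset.card_val]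
  exact (Finset.card_lt_univ_of_notMem (x := i) (by simp)).trans_eq (Fintype.card_fin k)

lemma le_two_mul_card_heard_iff (hs : I.shepherd ∉ I.byz) (hbyz : I.byz.card < k / 2) {v : V}
    (hflock : ∀ i ∈ I.flock, (cfg i).loc = v) :
    k ≤ 2 * (heard A I adv t cfg I.shepherd).card ↔ (cfg I.shepherd).loc = v := by
  classical
  have hcard := I.card_flock hs
  set S := Finset.univ.filter fun j => j ≠ I.shepherd ∧ (cfg j).loc = (cfg I.shepherd).loc with hS
  have hheard : (heard A I adv t cfg I.shepherd).card = S.card := by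
    simp only [heard, Multiset.card_map, Finset.card_val, hS]
  rw [hheard]
  constructor
  · intro hmajority
    by_contra hne
    have hsub : S ⊆ I.byz := fun j hj => by
      obtain ⟨hj, hloc⟩ : j ≠ I.shepherd ∧ (cfg j).loc = (cfg I.shepherd).loc := by
        simpa [hS] using hj
      by_contra hjbyz
      exact hne (hloc.symm.trans (hflock j (Instance.mem_flock.2 ⟨hj, hjbyz⟩)))
    have := Finset.card_le_card hsub
    omega
  · intro hv
    have hsub : I.flock ⊆ S := fun j hj => by
      simpa [hS, hv] using ⟨(Instance.mem_flock.1 hj).1, hflock j hj⟩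
    have := Finset.card_le_card hsub
    omega

open Classical in
lemma filter_isShepherd_heard (hi : i ≠ I.shepherd) :
    (heard A I adv t cfg i).filter (fun s => s.isShepherd) =
      if (cfg I.shepherd).loc = (cfg i).loc then {shoutOf A I adv t cfg I.shepherd} else 0 := by
  rw [heard, Multiset.filter_map, ← Finset.filter_val, Finset.filter_filter]
  split_ifs with hloc
  · have : (Finset.univ.filter fun j => (j ≠ i ∧ (cfg j).loc = (cfg i).loc) ∧
        ((fun s : Shout A.Msg => s.isShepherd = true) ∘ shoutOf A I adv t cfg) j) =
        {I.shepherd} := by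
      ext j
      simp only [Function.comp_apply, shoutOf, decide_eq_true_eq, Finset.mem_filter,
        Finset.mem_univ, true_and, Finset.mem_singleton]
      exact ⟨And.right, fun hj => ⟨⟨hj ▸ hi.symm, hj ▸ hloc⟩, hj⟩⟩
    rw [this]
    rfl
  · rw [Finset.filter_eq_empty_iff.2 ?_]
    · rfl
    · rintro j - ⟨⟨-, hj⟩, hshep⟩
      obtain rfl : j = I.shepherd := of_decide_eq_true hshep
      exact hloc hj

variable [Fintype V]

lemma config_succ_of_memory_eq_some {s : A.State} (hi : i ∉ I.byz)
    (hs : (config A I adv t i).memory = some s) :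
    config A I adv (t + 1) i = perform I (config A I adv t i).loc
      (A.step s (viewOf I (config A I adv t i)) (heard A I adv t (config A I adv t) i)) := by
  simp only [config, next, if_neg hi, hs]
  rcases A.step s _ _ with ⟨s', _ | p | _⟩ <;> rfl

lemma config_add_of_memory_eq_none (hi : i ∉ I.byz) (hm : (config A I adv t i).memory = none)
    (d : ℕ) : config A I adv (t + d) i = config A I adv t i := by
  induction d with
  | zero => rfl
  | succ d ih =>
    rw [← ih] at hm ⊢
    change next A I adv (t + d) (config A I adv (t + d)) i = _
    simp only [next, if_neg hi, hm]

end Execution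

/-! ### Programs of the shepherd -/

/-- What the shepherd perceives in one round: its node, and the labels of the other robots there. -/
structure Observation where
  view : View
  labels : Multiset ℕ

/-- What the shepherd may do in one round of a program: stay, walk alone, or walk together with
the flock. -/
inductive Move where
  | stay
  | solo (port : ℕ)
  | lead (port : ℕ)

/-- An interactive program of the shepherd: in each round a move is made, and the program goes on
depending on the observation made before this move. (The move is announced to the flock before
the shepherd hears anything, and so cannot depend on this observation.) -/
inductive Prog (α : Type) : Type where
  | ret (a : α)
  | act (m : Move) (next : Observation → Prog α)

namespace Prog

/-- Sequential composition of programs. -/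
def andThen {α β : Type} : Prog α → (α → Prog β) → Prog β
  | ret a, f => f a
  | act m κ, f => act m fun o => (κ o).andThen f

instance : Monad Prog where
  pure := ret
  bind := andThen

/-- Stay for one round and report the observation. -/
def observe : Prog Observation := act .stay ret

/-- Make a move and report the observation after it, which takes another round. -/
def go (m : Move) : Prog Observation := act m fun _ => observe

/-- Leave through the listed ports in turn, alone or leading the flock according to `move`. -/
def walk (move : ℕ → Move) (ps : List ℕ) : Prog Unit :=
  ps.forM fun p => act (move p) fun _ => pure ()

end Prog

/-- Where the shepherd and the flock are, and the port through which the shepherd has just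
entered. -/
structure Situation (V : Type) where
  leader : V
  entry : Option ℕ
  flock : V

namespace Situation

variable {V : Type}

/-- The shepherd is on `u` and the flock on `v`. -/
structure Placed (w : Situation V) (u v : V) : Prop where
  leader : w.leader = u
  flock : w.flock = v

open Classical in
/-- The situation after a move of the shepherd. The flock goes along only if it is on the node of
the shepherd. -/
noncomputable def after (G : PortGraph V) (w : Situation V) : Move → Situation V
  | .stay => ⟨w.leader, none, w.flock⟩
  | .solo p => ⟨(G.leave w.leader p).1, (G.leave w.leader p).2, w.flock⟩
  | .lead p => ⟨(G.leave w.leader p).1, (G.leave w.leader p).2,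
      if w.leader = w.flock then (G.leave w.leader p).1 else w.flock⟩

/-- What can be relied on in an observation, whatever the Byzantine robots do. -/
structure Observes {k : ℕ} (I : Instance V k) (w : Situation V) (o : Observation) : Prop where
  view : o.view = ⟨I.net.deg w.leader, I.cap w.leader, w.entry⟩
  card_lt : o.labels.card < k
  le_two_mul_card_iff : k ≤ 2 * o.labels.card ↔ w.leader = w.flock
  mem_labels : w.leader = w.flock → ∀ i ∈ I.flock, I.id i ∈ o.labels

end Situation

namespace Prog

/-- Total correctness with a time bound: started in the situation `w`, the program ends after at
most `B` rounds with a result and a situation satisfying `Q`. -/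
def Within {V : Type} {k : ℕ} (I : Instance V k) {α : Type} :
    Prog α → Situation V → ℕ → (α → Situation V → Prop) → Prop
  | ret a, w, _, Q => Q a w
  | act _ _, _, 0, _ => False
  | act m κ, w, B + 1, Q => ∀ o, w.Observes I o → (κ o).Within I (w.after I.net m) B Q

variable {V : Type} {k : ℕ} {I : Instance V k} {α β γ : Type} {w : Situation V} {B C : ℕ}

lemma Within.mono {P : Prog α} {Q : α → Situation V → Prop} (h : P.Within I w B Q)
    (hBC : B ≤ C) : P.Within I w C Q := by
  induction P generalizing w B C with
  | ret a => exact h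
  | act m κ ih =>
    match B, C, hBC with
    | B + 1, C + 1, hBC => exact fun o ho => ih o (h o ho) (Nat.le_of_succ_le_succ hBC)

lemma Within.imp {P : Prog α} {Q R : α → Situation V → Prop} (h : P.Within I w B Q)
    (hQR : ∀ a w', Q a w' → R a w') : P.Within I w B R := by
  induction P generalizing w B with
  | ret a => exact hQR _ _ h
  | act m κ ih =>
    match B with
    | B + 1 => exact fun o ho => ih o (h o ho)

lemma Within.bind {P : Prog α} {f : α → Prog β} {Q : α → Situation V → Prop}
    {R : β → Situation V → Prop} (h : P.Within I w B Q)
    (hf : ∀ a w', Q a w' → (f a).Within I w' C R) : (P >>= f).Within I w (B + C) R := by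
  induction P generalizing w B with
  | ret a => exact (hf a w h).mono (Nat.le_add_left C B)
  | act m κ ih =>
    match B with
    | B + 1 =>
      rw [Nat.succ_add]
      exact fun o ho => ih o (h o ho)

lemma within_pure {a : α} {Q : α → Situation V → Prop} (h : Q a w) :
    (pure a : Prog α).Within I w 0 Q := h

lemma within_observe :
    observe.Within I w 1 fun o w' => w.Observes I o ∧ w'.Placed w.leader w.flock :=
  fun _ ho => ⟨ho, rfl, rfl⟩

lemma within_go (m : Move) :
    (go m).Within I w 2 fun o w' => (w.after I.net m).Observes I o ∧
      w'.Placed (w.after I.net m).leader (w.after I.net m).flock :=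
  fun _ _ => within_observe

lemma within_walk_solo {u v : V} (ps : List ℕ) (hw : w.Placed u v) :
    (walk .solo ps).Within I w ps.length fun _ w' => w'.Placed (I.net.follow u ps) v := by
  induction ps generalizing u w with
  | nil => exact hw
  | cons _ _ ih => exact fun _ _ => ih ⟨by rw [← hw.leader]; rfl, hw.flock⟩

lemma within_walk_lead {u : V} (ps : List ℕ) (hw : w.Placed u u) :
    (walk .lead ps).Within I w ps.length fun _ w' =>
      w'.Placed (I.net.follow u ps) (I.net.follow u ps) := by
  induction ps generalizing u w with
  | nil => exact hw
  | cons _ _ ih =>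
    obtain ⟨rfl, hflock⟩ := hw
    exact fun _ _ => ih ⟨rfl, if_pos hflock.symm⟩

lemma within_flatMapM {f : β → Prog (List γ)} {W : Situation V → Prop} {S : β → γ → Prop}
    {l : List β}
    (h : ∀ b ∈ l, ∀ w, W w → (f b).Within I w B fun r w' => W w' ∧ ∀ c, c ∈ r ↔ S b c)
    (hw : W w) :
    (l.flatMapM f).Within I w (l.length * B) fun r w' => W w' ∧ ∀ c, c ∈ r ↔ ∃ b ∈ l, S b c := by
  suffices loop : ∀ acc, (List.flatMapM.loop f l acc).Within I w (l.length * B) fun r w' =>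
      W w' ∧ ∀ c, c ∈ r ↔ c ∈ acc.flatten ∨ ∃ b ∈ l, S b c by
    simpa [List.flatMapM] using loop []
  intro acc
  induction l generalizing w acc with
  | nil => exact ⟨hw, by simp⟩
  | cons b l ih =>
    rw [List.length_cons, Nat.add_mul, Nat.one_mul, Nat.add_comm]
    refine (h b List.mem_cons_self w hw).bind fun r w₁ ⟨hw₁, hr⟩ => ?_
    refine (ih (fun b' hb' => h b' (List.mem_cons_of_mem b hb')) hw₁ (r :: acc)).imp
      fun s w₂ ⟨hw₂, hs⟩ => ⟨hw₂, fun c => ?_⟩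
    rw [hs, List.flatten_cons, List.mem_append, hr, List.exists_mem_cons_iff]
    tauto

end Prog

/-! ### The algorithm -/

/-- What the shepherd records of a node: ports leading there from the root, ports leading back to
the root, degree and capacity. -/
structure Record where
  path : List ℕ
  back : List ℕ
  degree : ℕ
  capacity : ℕ

/-- A port of a recorded node, which is identified by the path to it. -/
abbrev PortMark := List ℕ × ℕ

section Algorithm

open Prog

/-- With the flock on the node `y` and the shepherd on the node `x`: if port `p` leads to the
flock, report this port and the port at `y` leading back. -/
def probe (k : ℕ) (x y : Record) (p : ℕ) : Prog (List PortMark) := do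
  let o ← go (.solo p)
  let r := o.view.entry.getD 0
  walk .solo [r]
  pure (if k ≤ 2 * o.labels.card then [(x.path, p), (y.path, r)] else [])

/-- With the flock on the node `y`: starting from the root, probe all ports of the node `x`, and
return to the root. -/
def inspect (k : ℕ) (y x : Record) : Prog (List PortMark) := do
  walk .solo x.path
  let marks ← (List.range x.degree).flatMapM (probe k x y)
  walk .solo x.back
  pure marks

/-- With the flock and the shepherd on the node `y`: find the ports connecting `y` with the
recorded nodes, then lead the flock to the root. -/
def survey (k : ℕ) (y : Record) (N : List Record) : Prog (List PortMark) := do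
  walk .solo y.back
  let marks ← N.flatMapM (inspect k y)
  walk .solo y.path
  walk .lead y.back
  pure marks

/-- Lead the flock from the root through port `p` of the node `x`, and record the node reached. -/
def discover (x : Record) (p : ℕ) : Prog Record := do
  walk .lead x.path
  let o ← go (.lead p)
  pure ⟨x.path ++ [p], o.view.entry.getD 0 :: x.back, o.view.degree, o.view.capacity⟩

/-- A port of a recorded node that is not marked. -/
def openPort (N : List Record) (M : List PortMark) : Option (Σ _ : Record, ℕ) :=
  (N.sigma fun x => List.range x.degree).find? fun s => (s.1.path, s.2) ∉ M

/-- Record new nodes as long as there are unmarked ports, at most `t` of them. The marked ports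
are those between recorded nodes. -/
def explore (k : ℕ) : ℕ → List Record → List PortMark → Prog (List Record)
  | 0, N, _ => pure N
  | t + 1, N, M =>
    match openPort N M with
    | none => pure N
    | some ⟨x, p⟩ => do
      let y ← discover x p
      let marks ← survey k y N
      explore k t (y :: N) (marks ++ M)

/-- The places offered by the recorded nodes, each node occurring as often as its capacity. -/
def slots (N : List Record) : List (Σ _ : Record, ℕ) :=
  N.sigma fun x => List.range x.capacity

/-- Assign the labels in the list `L` to distinct places; the value is the path to the place. -/
def assign (N : List Record) (L : List ℕ) (a : ℕ) : List ℕ :=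
  ((slots N)[L.idxOf a]?.map fun s => s.1.path).getD []

/-- The program of the shepherd; its result tells each label the path to its final node. -/
def shepherdProg (n k id : ℕ) : Prog (ℕ → List ℕ) := do
  let o ← observe
  let N ← explore k n [⟨[], [], o.view.degree, o.view.capacity⟩] []
  pure (assign N (id :: o.labels.sort (· ≤ ·)))

/-- The memory of a robot: the shepherd executing its program, a member of the flock, or a robot
walking to its final node. -/
inductive Memory where
  | leading (id : ℕ) (P : Prog (ℕ → List ℕ))
  | following (id : ℕ)
  | walking (ps : List ℕ)

/-- What the shepherd tells the flock to do. -/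
inductive Instruction where
  | idle
  | follow (port : ℕ)
  | disperse (g : ℕ → List ℕ)

/-- The instruction given in the current round of a program. -/
def Prog.instruction : Prog (ℕ → List ℕ) → Instruction
  | ret g => .disperse g
  | act (.lead p) _ => .follow p
  | act _ _ => .idle

/-- The message shouted by a robot. -/
def Memory.speak : Memory → Instruction
  | leading _ P => P.instruction
  | _ => .idle

/-- The action of the shepherd that carries out a move. -/
def Move.action : Move → Action
  | stay => .stay
  | solo p => .move p
  | lead p => .move p

/-- How a member of the flock obeys an instruction. -/
def obey (id : ℕ) : Instruction → Memory × Action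
  | .idle => (.following id, .stay)
  | .follow p => (.following id, .move p)
  | .disperse g => (.walking (g id), .stay)

/-- The instruction of the shepherd among the shouts heard, `idle` if there is none. -/
noncomputable def heardInstruction (h : Multiset (Shout Instruction)) : Instruction :=
  ((h.filter (·.isShepherd)).toList.head?.bind Shout.msg).getD .idle

/-- The computation and action of a robot in one round. -/
noncomputable def Memory.step :
    Memory → View → Multiset (Shout Instruction) → Memory × Action
  | leading id (.ret g), _, _ => (walking (g id), .stay)
  | leading id (.act m κ), view, h => (leading id (κ ⟨view, h.map Shout.label⟩), m.action)
  | following id, _, h => obey id (heardInstruction h)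
  | walking [], _, _ => (walking [], .terminate)
  | walking (p :: ps), _, _ => (walking ps, .move p)

/-- The dispersion algorithm. -/
noncomputable abbrev dispersionAlgorithm : Algorithm where
  State := Memory
  Msg := Instruction
  initShepherd n k id := .leading id (shepherdProg n k id)
  initRobot := .following
  speak s _ := s.speak
  step := Memory.step

end Algorithm

/-! ### Executions of the algorithm -/

section Simulation

variable {V : Type} [Fintype V] {k : ℕ} {I : Instance V k} {adv : Adversary Instruction k}

variable (I adv) in
/-- After `t` rounds the situation is `w`, and the shepherd is about to execute the program `P`. -/
structure Simulates (t : ℕ) (w : Situation V) (P : Prog (ℕ → List ℕ)) : Prop where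
  shepherd : config dispersionAlgorithm I adv t I.shepherd =
    ⟨w.leader, w.entry, some (.leading (I.id I.shepherd) P)⟩
  flock : ∀ i ∈ I.flock, ∃ e,
    config dispersionAlgorithm I adv t i = ⟨w.flock, e, some (.following (I.id i))⟩

variable {t : ℕ} {i : Fin k}

lemma simulates_zero {root : V} (hstart : ∀ i, I.start i = root) :
    Simulates I adv 0 ⟨root, none, root⟩
      (shepherdProg (Fintype.card V) k (I.id I.shepherd)) where
  shepherd := by simp [config, initial, hstart]
  flock i hi := by simp [config, initial, hstart, (Instance.mem_flock.1 hi).1]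

namespace Simulates

variable {w : Situation V} {P : Prog (ℕ → List ℕ)}

lemma observes (h : Simulates I adv t w P) (hs : I.shepherd ∉ I.byz) (hbyz : I.byz.card < k / 2) :
    w.Observes I ⟨viewOf I (config dispersionAlgorithm I adv t I.shepherd),
      (heard dispersionAlgorithm I adv t (config dispersionAlgorithm I adv t) I.shepherd).map
        Shout.label⟩ := by
  have hflock : ∀ i ∈ I.flock, (config dispersionAlgorithm I adv t i).loc = w.flock :=
    fun i hi => by
      obtain ⟨e, he⟩ := h.flock i hi
      rw [he]
  constructor
  · simp only [viewOf, h.shepherd]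
  · simpa only [Multiset.card_map] using card_heard_lt _ _
  · rw [Multiset.card_map, le_two_mul_card_heard_iff hs hbyz hflock, h.shepherd]
  · intro hmeet i hi
    obtain ⟨his, hibyz⟩ := Instance.mem_flock.1 hi
    refine Multiset.mem_map.2 ⟨_, shoutOf_mem_heard (j := i) his ?_, ?_⟩
    · rw [hflock i hi, h.shepherd, hmeet]
    · exact if_neg hibyz

open Classical in
lemma heardInstruction_eq (h : Simulates I adv t w P) (hs : I.shepherd ∉ I.byz)
    (hi : i ∈ I.flock) :
    heardInstruction (heard dispersionAlgorithm I adv t (config dispersionAlgorithm I adv t) i) =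
      if w.leader = w.flock then P.instruction else .idle := by
  obtain ⟨e, he⟩ := h.flock i hi
  rw [heardInstruction, filter_isShepherd_heard (A := dispersionAlgorithm)
    (Instance.mem_flock.1 hi).1, he, h.shepherd]
  split_ifs <;> simp [shoutOf, hs, h.shepherd, Memory.speak]

lemma shepherd_succ (h : Simulates I adv t w P) (hs : I.shepherd ∉ I.byz) :
    config dispersionAlgorithm I adv (t + 1) I.shepherd = perform I w.leader
      ((Memory.leading (I.id I.shepherd) P).step
        (viewOf I (config dispersionAlgorithm I adv t I.shepherd))
        (heard dispersionAlgorithm I adv t (config dispersionAlgorithm I adv t) I.shepherd)) := by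
  rw [config_succ_of_memory_eq_some hs (congrArg RobotState.memory h.shepherd), h.shepherd]

open Classical in
lemma flock_succ (h : Simulates I adv t w P) (hs : I.shepherd ∉ I.byz) (hi : i ∈ I.flock) :
    config dispersionAlgorithm I adv (t + 1) i = perform I w.flock
      (obey (I.id i) (if w.leader = w.flock then P.instruction else .idle)) := by
  obtain ⟨e, he⟩ := h.flock i hi
  rw [config_succ_of_memory_eq_some (Instance.mem_flock.1 hi).2 (congrArg RobotState.memory he),
    ← h.heardInstruction_eq hs hi, he]
  rfl

lemma step {m : Move} {κ : Observation → Prog (ℕ → List ℕ)} (h : Simulates I adv t w (.act m κ))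
    (hs : I.shepherd ∉ I.byz) (hbyz : I.byz.card < k / 2) :
    ∃ o, w.Observes I o ∧ Simulates I adv (t + 1) (w.after I.net m) (κ o) := by
  refine ⟨_, h.observes hs hbyz, ?_, fun i hi => ?_⟩
  · rw [h.shepherd_succ hs]
    cases m <;> simp only [Memory.step, Move.action, perform, depart_eq_leave, Situation.after]
  · rw [h.flock_succ hs hi]
    by_cases hmeet : w.leader = w.flock <;> cases m <;>
      simp [hmeet, Prog.instruction, obey, perform, depart_eq_leave, Situation.after]

lemma exists_of_within {B : ℕ} {Q : (ℕ → List ℕ) → Situation V → Prop}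
    (h : Simulates I adv t w P) (hs : I.shepherd ∉ I.byz) (hbyz : I.byz.card < k / 2)
    (hP : P.Within I w B Q) :
    ∃ t' ≤ t + B, ∃ g w', Simulates I adv t' w' (.ret g) ∧ Q g w' := by
  induction P generalizing t w B with
  | ret g => exact ⟨t, Nat.le_add_right t B, g, w, h, hP⟩
  | act m κ ih =>
    match B with
    | B + 1 =>
      obtain ⟨o, ho, hstep⟩ := h.step hs hbyz
      obtain ⟨t', ht', hsim⟩ := ih o hstep (hP o ho)
      exact ⟨t', by omega, hsim⟩

lemma config_succ_of_ret {g : ℕ → List ℕ} {v : V} (h : Simulates I adv t w (.ret g))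
    (hs : I.shepherd ∉ I.byz) (hw : w.Placed v v) (hi : i ∉ I.byz) :
    config dispersionAlgorithm I adv (t + 1) i = ⟨v, none, some (.walking (g (I.id i)))⟩ := by
  obtain ⟨hleader, hflock⟩ := hw
  by_cases his : i = I.shepherd
  · rw [his, h.shepherd_succ hs, hleader]
    rfl
  · rw [h.flock_succ hs (Instance.mem_flock.2 ⟨his, hi⟩), hleader, hflock, if_pos rfl]
    rfl

end Simulates

lemma config_of_memory_eq_walking {ps : List ℕ} (hi : i ∉ I.byz)
    (hm : (config dispersionAlgorithm I adv t i).memory = some (.walking ps)) :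
    config dispersionAlgorithm I adv (t + ps.length + 1) i =
      ⟨I.net.follow (config dispersionAlgorithm I adv t i).loc ps, none, none⟩ := by
  have hsucc := config_succ_of_memory_eq_some hi hm
  induction ps generalizing t with
  | nil => exact hsucc
  | cons p ps ih =>
    simp only [Memory.step, perform, depart_eq_leave] at hsucc
    have hm' := congrArg RobotState.memory hsucc
    rw [List.length_cons, ← Nat.add_assoc, Nat.add_right_comm t,
      ih hm' (config_succ_of_memory_eq_some hi hm'), hsucc]
    rfl

end Simulation

/-! ### Exploration -/

section Exploration

open Prog PortGraph

variable {V : Type} {k : ℕ} (I : Instance V k) (root : V)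

/-- The node described by a record. -/
def Record.node (x : Record) : V := I.net.follow root x.path

/-- The record is true to the graph, and its way back is as long as its way there. -/
structure Record.Correct (x : Record) : Prop where
  back : I.net.follow (x.node I root) x.back = root
  length_back : x.back.length = x.path.length
  degree : x.degree = I.net.deg (x.node I root)
  capacity : x.capacity = I.cap (x.node I root)

/-- The mark `c` stands for a port of the node recorded by `x` that leads to the node recorded
by `y`. -/
def Record.IsPortTo (x y : Record) (c : PortMark) : Prop :=
  ∃ p r, I.net.traverse (x.node I root) p = some (y.node I root, r) ∧ c = (x.path, p)

/-- The records in `N` are correct and describe distinct nodes, the root among them, and all paths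
are short. -/
structure IsPartialMap (N : List Record) : Prop where
  correct : ∀ x ∈ N, x.Correct I root
  nodup : (N.map (Record.node I root)).Nodup
  length_path_lt : ∀ x ∈ N, x.path.length < N.length
  root_mem : root ∈ N.map (Record.node I root)

/-- The invariant of the exploration: the ports in `M` are those between recorded nodes. -/
structure IsMarkedMap (N : List Record) (M : List PortMark) : Prop
    extends IsPartialMap I root N where
  mem_marks_iff : ∀ c, c ∈ M ↔ ∃ x ∈ N, ∃ y ∈ N, x.IsPortTo I root y c

variable {I root} {x y : Record} {c : PortMark} {w : Situation V} {N : List Record}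
  {M : List PortMark}

lemma Record.isPortTo_or_isPortTo_iff :
    x.IsPortTo I root y c ∨ y.IsPortTo I root x c ↔
      ∃ p r, I.net.traverse (x.node I root) p = some (y.node I root, r) ∧
        (c = (x.path, p) ∨ c = (y.path, r)) := by
  constructor
  · rintro (⟨p, r, hpr, rfl⟩ | ⟨r, p, hrp, rfl⟩)
    · exact ⟨p, r, hpr, .inl rfl⟩
    · exact ⟨p, r, traverse_symm hrp, .inr rfl⟩
  · rintro ⟨p, r, hpr, rfl | rfl⟩
    · exact .inl ⟨p, r, hpr, rfl⟩
    · exact .inr ⟨r, p, traverse_symm hpr, rfl⟩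

lemma Record.not_isPortTo_self : ¬ x.IsPortTo I root x c :=
  fun ⟨_, _, hpr, _⟩ => (adj_of_traverse hpr).ne rfl

lemma within_probe {p : ℕ} (hp : p < I.net.deg (x.node I root))
    (hw : w.Placed (x.node I root) (y.node I root)) :
    (probe k x y p).Within I w 3 fun marks w' =>
      w'.Placed (x.node I root) (y.node I root) ∧
      ∀ c, c ∈ marks ↔ ∃ r, I.net.traverse (x.node I root) p = some (y.node I root, r) ∧
        (c = (x.path, p) ∨ c = (y.path, r)) := by
  obtain ⟨v, r, hpr⟩ := exists_traverse_of_lt_deg hp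
  have hafter : w.after I.net (.solo p) = ⟨v, some r, y.node I root⟩ := by
    simp only [Situation.after, hw.leader, hw.flock, leave_of_traverse hpr]
  have hgo := within_go (I := I) (w := w) (.solo p)
  rw [hafter] at hgo
  refine hgo.bind (C := 1 + 0) fun o w₁ ⟨ho, hw₁⟩ => ?_
  have hentry : o.view.entry.getD 0 = r := by simp [ho.view]
  simp only [hentry]
  refine (within_walk_solo [r] hw₁).bind fun _ w₂ hw₂ => within_pure ⟨?_, fun c => ?_⟩
  · rwa [follow_singleton_of_traverse (traverse_symm hpr)] at hw₂
  · have hmeet : k ≤ 2 * o.labels.card ↔ v = y.node I root := ho.le_two_mul_card_iff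
    simp only [hpr, Option.some.injEq, Prod.mk.injEq]
    by_cases hv : v = y.node I root <;> simp [hmeet, hv]

lemma within_inspect (hx : x.Correct I root) (hw : w.Placed root (y.node I root)) :
    (inspect k y x).Within I w (2 * x.path.length + 3 * x.degree) fun marks w' =>
      w'.Placed root (y.node I root) ∧
      ∀ c, c ∈ marks ↔ x.IsPortTo I root y c ∨ y.IsPortTo I root x c := by
  refine Within.mono ((within_walk_solo x.path hw).bind fun _ w₁ hw₁ =>
    (within_flatMapM (W := fun w => w.Placed (x.node I root) (y.node I root))
      (fun p hp w hw => within_probe (by simpa [hx.degree] using hp) hw) hw₁).bind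
    fun marks w₂ ⟨hw₂, hmarks⟩ =>
      (within_walk_solo x.back hw₂).bind fun _ w₃ hw₃ => within_pure ⟨?_, fun c => ?_⟩) ?_
  · rwa [hx.back] at hw₃
  · rw [hmarks, Record.isPortTo_or_isPortTo_iff]
    constructor
    · rintro ⟨p, -, hp⟩
      exact ⟨p, hp⟩
    · rintro ⟨p, r, hpr, hc⟩
      exact ⟨p, List.mem_range.2 (hx.degree ▸ lt_deg_of_traverse hpr), r, hpr, hc⟩
  · rw [List.length_range, hx.length_back]
    omega

lemma within_survey [Fintype V] (hy : y.Correct I root) (hN : ∀ x ∈ N, x.Correct I root)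
    (hpath : ∀ x ∈ y :: N, x.path.length ≤ Fintype.card V) (hlen : N.length ≤ Fintype.card V)
    (hw : w.Placed (y.node I root) (y.node I root)) :
    (survey k y N).Within I w (5 * Fintype.card V ^ 2 + 3 * Fintype.card V) fun marks w' =>
      w'.Placed root root ∧
      ∀ c, c ∈ marks ↔ ∃ x ∈ N, x.IsPortTo I root y c ∨ y.IsPortTo I root x c := by
  have hinspect : ∀ x ∈ N, ∀ w : Situation V, w.Placed root (y.node I root) →
      (inspect k y x).Within I w (5 * Fintype.card V) fun marks w' =>
        w'.Placed root (y.node I root) ∧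
        ∀ c, c ∈ marks ↔ x.IsPortTo I root y c ∨ y.IsPortTo I root x c := fun x hx w hw => by
    refine (within_inspect (hN x hx) hw).mono ?_
    have hdeg := (hN x hx).degree.trans_le (I.net.deg_le_card _)
    have := hpath x (List.mem_cons_of_mem y hx)
    omega
  have hylen := hpath y List.mem_cons_self
  refine Within.mono ((within_walk_solo y.back hw).bind fun _ w₁ hw₁ =>
    (within_flatMapM hinspect (by rwa [hy.back] at hw₁)).bind fun marks w₂ ⟨hw₂, hmarks⟩ =>
    (within_walk_solo y.path hw₂).bind fun _ w₃ hw₃ =>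
    (within_walk_lead y.back hw₃).bind fun _ w₄ hw₄ => within_pure ⟨?_, hmarks⟩) ?_
  · change w₄.Placed (I.net.follow (y.node I root) _) (I.net.follow (y.node I root) _) at hw₄
    rwa [hy.back] at hw₄
  · rw [hy.length_back]
    nlinarith

lemma within_discover {v : V} {p r : ℕ} (hx : x.Correct I root)
    (hpr : I.net.traverse (x.node I root) p = some (v, r)) (hw : w.Placed root root) :
    (discover x p).Within I w (x.path.length + 2) fun y w' =>
      w'.Placed v v ∧ y.Correct I root ∧ y.node I root = v ∧
        y.path.length = x.path.length + 1 := by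
  refine (within_walk_lead x.path hw).bind (C := 2 + 0) fun _ w₁ hw₁ => ?_
  have hafter : w₁.after I.net (.lead p) = ⟨v, some r, v⟩ := by
    have hleave : I.net.leave (I.net.follow root x.path) p = (v, some r) := leave_of_traverse hpr
    simp only [Situation.after, hw₁.leader, hw₁.flock, hleave, if_true]
  have hgo := within_go (I := I) (w := w₁) (.lead p)
  rw [hafter] at hgo
  refine hgo.bind fun o w₂ ⟨ho, hw₂⟩ => within_pure ?_
  simp only [ho.view, Option.getD_some]
  have hnode : ∀ back degree capacity,
      Record.node I root ⟨x.path ++ [p], back, degree, capacity⟩ = v := fun _ _ _ =>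
    (follow_append x.path [p]).trans (follow_singleton_of_traverse hpr)
  refine ⟨hw₂, ⟨?_, ?_, ?_, ?_⟩, hnode _ _ _, ?_⟩
  · rw [hnode, ← hx.back, ← follow_singleton_of_traverse (traverse_symm hpr), ← follow_append]
    rfl
  · simp [hx.length_back]
  · rw [hnode]
  · rw [hnode]
  · simp

lemma IsPartialMap.length_le [Fintype V] (h : IsPartialMap I root N) :
    N.length ≤ Fintype.card V := by
  simpa using h.nodup.length_le_card

lemma IsPartialMap.cons (h : IsPartialMap I root N) (hy : y.Correct I root)
    (hnew : y.node I root ∉ N.map (Record.node I root)) (hlen : y.path.length ≤ N.length) :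
    IsPartialMap I root (y :: N) where
  correct := List.forall_mem_cons.2 ⟨hy, h.correct⟩
  nodup := List.nodup_cons.2 ⟨hnew, h.nodup⟩
  length_path_lt := List.forall_mem_cons.2
    ⟨Nat.lt_succ_of_le hlen, fun x hx => (h.length_path_lt x hx).trans (Nat.lt_succ_self _)⟩
  root_mem := List.mem_cons_of_mem _ h.root_mem

lemma IsMarkedMap.singleton (hx : x.Correct I root) (hpath : x.path = []) :
    IsMarkedMap I root [x] [] where
  correct := List.forall_mem_singleton.2 hx
  nodup := List.nodup_singleton _
  length_path_lt := by simp [hpath]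
  root_mem := by simp [Record.node, hpath, follow]
  mem_marks_iff c := by simp [Record.not_isPortTo_self]

lemma IsMarkedMap.cons {marks : List PortMark} (h : IsMarkedMap I root N M)
    (hN : IsPartialMap I root (y :: N))
    (hmarks : ∀ c, c ∈ marks ↔ ∃ x ∈ N, x.IsPortTo I root y c ∨ y.IsPortTo I root x c) :
    IsMarkedMap I root (y :: N) (marks ++ M) where
  toIsPartialMap := hN
  mem_marks_iff c := by
    simp only [List.mem_append, hmarks, h.mem_marks_iff, List.exists_mem_cons_iff,
      Record.not_isPortTo_self, false_or]
    constructor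
    · rintro (⟨x, hx, hxy | hyx⟩ | ⟨x, hx, x', hx', hxx'⟩)
      · exact .inr ⟨x, hx, .inl hxy⟩
      · exact .inl ⟨x, hx, hyx⟩
      · exact .inr ⟨x, hx, .inr ⟨x', hx', hxx'⟩⟩
    · rintro (⟨x, hx, hyx⟩ | ⟨x, hx, hxy | ⟨x', hx', hxx'⟩⟩)
      · exact .inl ⟨x, hx, .inr hyx⟩
      · exact .inl ⟨x, hx, .inl hxy⟩
      · exact .inr ⟨x, hx, x', hx', hxx'⟩

lemma IsMarkedMap.complete (h : IsMarkedMap I root N M) (hconn : I.net.graph.Connected)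
    (hopen : openPort N M = none) (v : V) : v ∈ N.map (Record.node I root) := by
  have hclosed : ∀ {u v}, I.net.graph.Adj u v → u ∈ N.map (Record.node I root) →
      v ∈ N.map (Record.node I root) := by
    intro u v hadj hu
    obtain ⟨x, hx, rfl⟩ := List.mem_map.1 hu
    obtain ⟨p, r, hpr⟩ := exists_traverse_of_adj hadj
    have hmark : (x.path, p) ∈ M := by
      have hdeg := (h.correct x hx).degree ▸ lt_deg_of_traverse hpr
      simpa using List.find?_eq_none.1 hopen ⟨x, p⟩
        (List.mem_sigma.2 ⟨hx, List.mem_range.2 hdeg⟩)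
    obtain ⟨x', -, y, hy, p', r', hpr', hc⟩ := (h.mem_marks_iff _).1 hmark
    obtain ⟨hpath, rfl⟩ := Prod.mk.inj hc
    rw [show x'.node I root = x.node I root by rw [Record.node, ← hpath]; rfl, hpr] at hpr'
    obtain ⟨rfl, -⟩ := Prod.mk.inj (Option.some.inj hpr')
    exact List.mem_map_of_mem hy
  induction (SimpleGraph.reachable_iff_reflTransGen root v).1 (hconn.preconnected root v) with
  | refl => exact h.root_mem
  | tail _ hadj ih => exact hclosed hadj ih

lemma IsMarkedMap.exists_of_openPort {p : ℕ} (h : IsMarkedMap I root N M)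
    (hopen : openPort N M = some ⟨x, p⟩) :
    x ∈ N ∧ ∃ v r, I.net.traverse (x.node I root) p = some (v, r) ∧
      v ∉ N.map (Record.node I root) := by
  obtain ⟨hx, hp⟩ := List.mem_sigma.1 (List.mem_of_find?_eq_some hopen)
  have hmark : (x.path, p) ∉ M := by simpa using List.find?_some hopen
  obtain ⟨v, r, hpr⟩ := exists_traverse_of_lt_deg
    ((h.correct x hx).degree ▸ List.mem_range.1 hp)
  refine ⟨hx, v, r, hpr, fun hv => hmark ?_⟩
  obtain ⟨y, hy, rfl⟩ := List.mem_map.1 hv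
  exact (h.mem_marks_iff _).2 ⟨x, hx, y, hy, p, r, hpr, rfl⟩

lemma within_explore [Fintype V] (hconn : I.net.graph.Connected) {t : ℕ}
    (h : IsMarkedMap I root N M) (ht : Fintype.card V < t + N.length) (hw : w.Placed root root) :
    (explore k t N M).Within I w (t * (10 * Fintype.card V ^ 2)) fun N' w' =>
      w'.Placed root root ∧ IsPartialMap I root N' ∧
        ∀ v, v ∈ N'.map (Record.node I root) := by
  induction t generalizing N M w with
  | zero => exact absurd h.length_le (by omega)
  | succ t ih =>
    unfold explore
    rcases hopen : openPort N M with _ | ⟨x, p⟩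
    · exact Within.mono (within_pure ⟨hw, h.toIsPartialMap, h.complete hconn hopen⟩)
        (Nat.zero_le _)
    obtain ⟨hx, v, r, hpr, hnew⟩ := h.exists_of_openPort hopen
    have hcard := h.length_le
    have hxlen := h.length_path_lt x hx
    refine Within.mono ((within_discover (h.correct x hx) hpr hw).bind
      (C := (5 * Fintype.card V ^ 2 + 3 * Fintype.card V) + t * (10 * Fintype.card V ^ 2))
      fun y w₁ ⟨hw₁, hy, hyv, hylen⟩ => ?_) ?_
    · subst hyv
      have hN := h.toIsPartialMap.cons hy hnew (by omega)
      refine (within_survey hy h.correct (fun z hz => ?_) hcard hw₁).bind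
        fun marks w₂ ⟨hw₂, hmarks⟩ => ih (h.cons hN hmarks) ?_ hw₂
      · exact (hN.length_path_lt z hz).le.trans hN.length_le
      · rw [List.length_cons]
        omega
    · have : x.path.length + 2 ≤ 2 * Fintype.card V := by omega
      nlinarith

end Exploration

/-! ### Assignment of places -/

open Classical in
/-- If the non-Byzantine robots walk from `root` as told by `g`, then they arrive within
`Fintype.card V` rounds and respect the capacities. -/
structure Instance.IsDispersal {V : Type} [Fintype V] {k : ℕ} (I : Instance V k) (root : V)
    (g : ℕ → List ℕ) : Prop where
  length_le : ∀ i ∉ I.byz, (g (I.id i)).length ≤ Fintype.card V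
  card_le : ∀ u,
    (Finset.univ.filter fun i => i ∉ I.byz ∧ I.net.follow root (g (I.id i)) = u).card ≤ I.cap u

section Assignment

variable {V : Type} {k : ℕ} {I : Instance V k} {root : V} {N : List Record} {L : List ℕ} {a : ℕ}

lemma exists_slot (hlen : L.length ≤ (slots N).length) (ha : a ∈ L) :
    ∃ x ∈ N, ∃ c < x.capacity, (slots N)[L.idxOf a]? = some ⟨x, c⟩ ∧ assign N L a = x.path := by
  have hlt := (List.idxOf_lt_length_of_mem ha).trans_le hlen
  have hslot := List.getElem?_eq_getElem hlt
  obtain ⟨hx, hc⟩ := List.mem_sigma.1 (List.getElem_mem hlt)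
  exact ⟨_, hx, _, List.mem_range.1 hc, hslot, by rw [assign, hslot]; rfl⟩

lemma IsPartialMap.length_slots [Fintype V] (hN : IsPartialMap I root N)
    (hall : ∀ v, v ∈ N.map (Record.node I root)) : (slots N).length = ∑ v, I.cap v := by
  classical
  calc (slots N).length = (N.map fun x => x.capacity).sum := by
        simp [slots, List.length_sigma]
    _ = ((N.map (Record.node I root)).map I.cap).sum := by
        rw [List.map_map]
        exact congrArg List.sum (List.map_congr_left fun x hx => (hN.correct x hx).capacity)
    _ = ∑ v ∈ (N.map (Record.node I root)).toFinset, I.cap v :=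
        (List.sum_toFinset I.cap hN.nodup).symm
    _ = ∑ v, I.cap v := by
        rw [Finset.eq_univ_iff_forall.2 fun v => List.mem_toFinset.2 (hall v)]

lemma IsPartialMap.nodup_slots (hN : IsPartialMap I root N) : (slots N).Nodup :=
  hN.nodup.of_map.sigma fun _ => List.nodup_range

lemma IsPartialMap.card_assign_le (hN : IsPartialMap I root N)
    (hlen : L.length ≤ (slots N).length) {x : Record} (hx : x ∈ N) {S : Finset ℕ}
    (hS : ∀ a ∈ S, a ∈ L ∧ I.net.follow root (assign N L a) = x.node I root) :
    S.card ≤ x.capacity := by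
  classical
  calc S.card
      ≤ ((Finset.range x.capacity).image fun c => some (⟨x, c⟩ : Σ _ : Record, ℕ)).card := by
        refine Finset.card_le_card_of_injOn (fun a => (slots N)[L.idxOf a]?)
          (fun a ha => ?_) fun a ha b _ hab => ?_
        · obtain ⟨haL, hnode⟩ := hS a ha
          obtain ⟨y, hy, c, hc, hslot, hpath⟩ := exists_slot hlen haL
          obtain rfl : y = x :=
            List.inj_on_of_nodup_map hN.nodup hy hx (by rw [← hnode, hpath]; rfl)
          simpa [hslot] using hc
        · have haL := (hS a ha).1
          have hlt := (List.idxOf_lt_length_of_mem haL).trans_le hlen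
          exact (List.idxOf_inj haL).1 ((List.getElem?_inj hlt hN.nodup_slots).1 hab)
    _ ≤ (Finset.range x.capacity).card := Finset.card_image_le
    _ = x.capacity := Finset.card_range _

lemma IsPartialMap.isDispersal_assign [Fintype V] (hN : IsPartialMap I root N)
    (hall : ∀ v, v ∈ N.map (Record.node I root)) (hid : Function.Injective I.id)
    (hL : ∀ i ∉ I.byz, I.id i ∈ L) (hlen : L.length ≤ ∑ v, I.cap v) :
    I.IsDispersal root (assign N L) where
  length_le i hi := by
    obtain ⟨x, hx, _, _, _, hpath⟩ :=
      exists_slot (hlen.trans_eq (hN.length_slots hall).symm) (hL i hi)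
    rw [hpath]
    exact (hN.length_path_lt x hx).le.trans hN.length_le
  card_le u := by
    classical
    obtain ⟨x, hx, rfl⟩ := List.mem_map.1 (hall u)
    rw [← Finset.card_image_of_injective _ hid, ← (hN.correct x hx).capacity]
    refine hN.card_assign_le (hlen.trans_eq (hN.length_slots hall).symm) hx fun a ha => ?_
    obtain ⟨i, hi, rfl⟩ := Finset.mem_image.1 ha
    obtain ⟨-, hibyz, hnode⟩ := Finset.mem_filter.1 hi
    exact ⟨hL i hibyz, hnode⟩

end Assignment

/-! ### Correctness of the algorithm -/

section Correctness

open Prog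

variable {V : Type} [Fintype V] {k : ℕ} {I : Instance V k} {root : V}

lemma within_shepherdProg (hconn : I.net.graph.Connected) (hcap : k ≤ ∑ v, I.cap v)
    (hid : Function.Injective I.id) {w : Situation V} (hw : w.Placed root root) :
    (shepherdProg (Fintype.card V) k (I.id I.shepherd)).Within I w
      (1 + Fintype.card V * (10 * Fintype.card V ^ 2)) fun g w' =>
        w'.Placed root root ∧ I.IsDispersal root g := by
  have hobserve := within_observe (I := I) (w := w)
  rw [hw.leader, hw.flock] at hobserve
  refine hobserve.bind (C := Fintype.card V * (10 * Fintype.card V ^ 2) + 0)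
    fun o w₁ ⟨ho, hw₁⟩ => ?_
  have hroot : Record.Correct I root ⟨[], [], o.view.degree, o.view.capacity⟩ :=
    ⟨rfl, rfl, by rw [ho.view, hw.leader]; rfl, by rw [ho.view, hw.leader]; rfl⟩
  refine (within_explore hconn (IsMarkedMap.singleton hroot rfl) (by simp) hw₁).bind
    fun N w₂ ⟨hw₂, hN, hall⟩ =>
      within_pure ⟨hw₂, hN.isDispersal_assign hall hid (fun i hi => ?_) ?_⟩
  · by_cases his : i = I.shepherd
    · exact his ▸ List.mem_cons_self
    · exact List.mem_cons_of_mem _ ((Multiset.mem_sort _).2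
        (ho.mem_labels (hw.leader.trans hw.flock.symm) i (Instance.mem_flock.2 ⟨his, hi⟩)))
  · rw [List.length_cons, Multiset.length_sort]
    exact (Nat.succ_le_of_lt ho.card_lt).trans hcap

lemma config_of_isDispersal {adv : Adversary Instruction k} {t : ℕ} {w : Situation V}
    {g : ℕ → List ℕ} (h : Simulates I adv t w (.ret g)) (hs : I.shepherd ∉ I.byz)
    (hw : w.Placed root root) (hg : I.IsDispersal root g) {i : Fin k} (hi : i ∉ I.byz) :
    config dispersionAlgorithm I adv (t + Fintype.card V + 2) i =
      ⟨I.net.follow root (g (I.id i)), none, none⟩ := by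
  have hstart := h.config_succ_of_ret hs hw hi
  have hend := config_of_memory_eq_walking hi (congrArg RobotState.memory hstart)
  rw [hstart] at hend
  obtain ⟨d, hd⟩ := Nat.exists_eq_add_of_le (hg.length_le i hi)
  rw [hd, show t + ((g (I.id i)).length + d) + 2 = t + 1 + (g (I.id i)).length + 1 + d by omega,
    config_add_of_memory_eq_none hi (congrArg RobotState.memory hend), hend]

lemma dispersedAt_of_isDispersal {adv : Adversary Instruction k} {t : ℕ} {w : Situation V}
    {g : ℕ → List ℕ} (h : Simulates I adv t w (.ret g)) (hs : I.shepherd ∉ I.byz)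
    (hw : w.Placed root root) (hg : I.IsDispersal root g) :
    DispersedAt dispersionAlgorithm I adv (t + Fintype.card V + 2) := by
  have hfinal := fun i hi => config_of_isDispersal h hs hw hg (i := i) hi
  refine ⟨fun i hi => by rw [hfinal i hi], fun u =>
    (Finset.card_le_card fun i hi => ?_).trans (hg.card_le u)⟩
  simp only [Finset.mem_filter, Finset.mem_univ, true_and] at hi ⊢
  simpa only [hfinal i hi.1] using hi

end Correctness

end ByzantineDispersion

open ByzantineDispersion in
theorem mainTheorem2_general {V : Type} [Fintype V] {k : ℕ} (I : Instance V k)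
    (hconn : I.net.graph.Connected) (hcap : k ≤ ∑ v, I.cap v) (hid : Function.Injective I.id)
    (hs : I.shepherd ∉ I.byz) (hbyz : I.byz.card < k / 2) (hgathered : I.Gathered) :
    SolvesWithin dispersionAlgorithm I (14 * Fintype.card V ^ 3) := by
  obtain ⟨root, hstart⟩ := hgathered
  intro (adv : Adversary Instruction k)
  obtain ⟨t, ht, g, w, hsim, hw, hg⟩ := (simulates_zero (adv := adv) hstart).exists_of_within
    hs hbyz (within_shepherdProg hconn hcap hid ⟨rfl, rfl⟩)
  refine ⟨t + Fintype.card V + 2, ?_, dispersedAt_of_isDispersal hsim hs hw hg⟩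
  have hpos : 0 < Fintype.card V := Fintype.card_pos_iff.2 ⟨root⟩
  have hcube : Fintype.card V ≤ Fintype.card V ^ 3 := Nat.le_self_pow (by norm_num) _
  calc t + Fintype.card V + 2 ≤ 10 * Fintype.card V ^ 3 + Fintype.card V + 3 := by linarith
    _ ≤ 14 * Fintype.card V ^ 3 := by omega

theorem mainTheorem2 :
    ∃ (A : ByzantineDispersion.Algorithm) (C : ℕ),
      ∀ (n k f p q : ℕ), 1 < k → 0 < p → 0 < q → f < (k - 1) / 2 →
        ∀ (V : Type) [Fintype V], Fintype.card V = n →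
          ∀ I : ByzantineDispersion.Instance V k, I.Valid f p q → I.Gathered →
            ByzantineDispersion.SolvesWithin A I (C * n ^ 3) :=
  ⟨ByzantineDispersion.dispersionAlgorithm, 14, fun _ _ _ _ _ _ _ _ hf _ _ hn I hI hgathered =>
    hn ▸ mainTheorem2_general I hI.connected hI.total_cap hI.id_injective hI.shepherd_honest
      (hI.card_byz_le.trans_lt (by omega)) hgathered⟩
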